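/- Let $n\ge 0$, let $\omega\in\mathbb{R}_{>0}^n$, and let $\mathbb{C}((x))$ denote the fraction field of $\mathbb{C}[[x]]=\mathbb{C}[[x_1,\dots,x_n]]$. For a nonzero power series $f=\sum_\alpha f_\alpha x^\alpha$ put $\nu_\omega(f)=\min\{\langle\omega,\alpha\rangle : f_\alpha\neq 0\}$, and for nonzero $f,g\in\mathbb{C}[[x]]$ put $\nu_\omega(f/g)=\nu_\omega(f)-\nu_\omega(g)$. Let $\widehat{\mathbb{C}((x))}^{\omega}$ be the completion of $\mathbb{C}((x))$ for the absolute value $|z|_\omega=e^{-\nu_\omega(z)}$ (with $|0|_\omega=0$), and extend $|\cdot|_\omega$ and $\nu_\omega=-\log|\cdot|_\omega$ to it (with $\nu_\omega(0)=+\infty$). A polynomial in $\mathbb{C}[x]$ is called $\omega$-weighted homogeneous if all monomials $x^\alpha$ occurring in it have the same weight $\langle\omega,\alpha\rangle$ (the zero polynomial is allowed). Let $\xi\in\widehat{\mathbb{C}((x))}^{\omega}$ be algebraic over $\mathbb{C}((x))$, and let $\ell_0\in\mathbb{R}$ with $\ell_0\le\nu_\omega(\xi)$ (for instance $\ell_0=\nu_\omega(\xi)$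 if $\xi\neq 0$). Then there are a nonzero $\omega$-weighted homogeneous polynomial $a(x)\in\mathbb{C}[x]$ and $\omega$-weighted homogeneous polynomials $a_\ell(x)\in\mathbb{C}[x]$, indexed by real numbers $\ell$, such that $a_\ell=0$ for $\ell<\ell_0$, only finitely many $a_\ell$ with $\ell\le r$ are nonzero for each $r\in\mathbb{R}$, $$\nu_\omega\!\left(\frac{a_\ell(x)}{a(x)^{\lceil \ell-\ell_0\rceil+1}}\right)=\ell\qquad\text{whenever } a_\ell\neq 0,$$ and $$\xi=\sum_{\ell\ge\ell_0}\frac{a_\ell(x)}{a(x)^{\lceil \ell-\ell_0\rceil+1}},$$ where the sum converges in $\widehat{\mathbb{C}((x))}^{\omega}$. -/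

import Mathlib

namespace WeightedSeries

variable {n : ℕ}

/-- The field `ℂ((x))`, `x = (x₁, …, xₙ)`: the fraction field of `ℂ⟦x₁, …, xₙ⟧`. -/
abbrev SeriesField (n : ℕ) : Type := FractionRing (MvPowerSeries (Fin n) ℂ)

/-- A polynomial viewed as an element of `ℂ((x))`. -/
noncomputable def ofPoly (p : MvPolynomial (Fin n) ℂ) : SeriesField n :=
  algebraMap (MvPowerSeries (Fin n) ℂ) (SeriesField n) (p : MvPowerSeries (Fin n) ℂ)

/-- `p` is `ω`-weighted homogeneous: all its nonzero monomials `x^α` have the same weight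
`⟨ω, α⟩` (a real number). The zero polynomial is homogeneous. -/
def IsWHomogeneous (ω : Fin n → ℝ) (p : MvPolynomial (Fin n) ℂ) : Prop :=
  ∃ m : ℝ, MvPolynomial.IsWeightedHomogeneous ω p m

/-- `ν_ω(f) = min {⟨ω, α⟩ | f_α ≠ 0}` for a power series `f ≠ 0` (for positive `ω` the minimum
exists, see `seriesVal_isLeast`; the value at `f = 0` is a junk value that is never used). -/
noncomputable def seriesVal (ω : Fin n → ℝ) (f : MvPowerSeries (Fin n) ℂ) : ℝ :=
  sInf {r : ℝ | ∃ α : Fin n →₀ ℕ, MvPowerSeries.coeff α f ≠ 0 ∧ Finsupp.weight ω α = r}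

/-- `ν_ω(f / g) = ν_ω(f) - ν_ω(g)` for `f, g ≠ 0`, computed from a chosen representation
as a fraction; it does not depend on the choice, see `val_div`. -/
noncomputable def val (ω : Fin n → ℝ) (z : SeriesField n) : ℝ :=
  seriesVal ω (IsLocalization.sec (nonZeroDivisors (MvPowerSeries (Fin n) ℂ)) z).1 -
    seriesVal ω (IsLocalization.sec (nonZeroDivisors (MvPowerSeries (Fin n) ℂ)) z).2

theorem finite_weight_le {ω : Fin n → ℝ} (hω : ∀ i, 0 < ω i) (r : ℝ) :
    {α : Fin n →₀ ℕ | Finsupp.weight ω α ≤ r}.Finite := by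
  classical
  have hsub : {α : Fin n →₀ ℕ | Finsupp.weight ω α ≤ r} ⊆
      Set.Iic (Finsupp.equivFunOnFinite.symm fun i => ⌊r / ω i⌋₊) := by
    intro α hα i
    have h1 : (α i : ℝ) * ω i ≤ r := by
      refine le_trans ?_ hα
      rw [Finsupp.weight_eq_sum]
      simp only [nsmul_eq_mul]
      exact Finset.single_le_sum (f := fun i => (α i : ℝ) * ω i)
        (fun j _ => mul_nonneg (Nat.cast_nonneg _) (hω j).le) (Finset.mem_univ i)
    have h2 : (α i : ℝ) ≤ r / ω i := (le_div_iff₀ (hω i)).2 h1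
    simpa using Nat.le_floor h2
  exact (Set.finite_Iic _).subset hsub

/-- The exponent of a nonzero series of minimal weight, ties being broken lexicographically. -/
theorem exists_lead {ω : Fin n → ℝ} (hω : ∀ i, 0 < ω i) {f : MvPowerSeries (Fin n) ℂ}
    (hf : f ≠ 0) : ∃ α : Fin n →₀ ℕ, MvPowerSeries.coeff α f ≠ 0 ∧
      ∀ β, MvPowerSeries.coeff β f ≠ 0 → Finsupp.weight ω α < Finsupp.weight ω β ∨
        (Finsupp.weight ω α = Finsupp.weight ω β ∧ toLex α ≤ toLex β) := by
  obtain ⟨γ, hγ⟩ : ∃ γ, MvPowerSeries.coeff γ f ≠ 0 := by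
    by_contra! h
    exact hf (MvPowerSeries.ext (by simpa using h))
  have hfin : {α : Fin n →₀ ℕ | MvPowerSeries.coeff α f ≠ 0 ∧
      Finsupp.weight ω α ≤ Finsupp.weight ω γ}.Finite :=
    (finite_weight_le hω _).subset fun _ h => h.2
  obtain ⟨α, ⟨hα1, hα2⟩, hmin⟩ := Set.exists_min_image _
    (fun α : Fin n →₀ ℕ => (toLex (Finsupp.weight ω α, toLex α) : ℝ ×ₗ Lex (Fin n →₀ ℕ)))
    hfin ⟨γ, hγ, le_rfl⟩
  refine ⟨α, hα1, fun β hβ => ?_⟩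
  by_cases h : Finsupp.weight ω β ≤ Finsupp.weight ω γ
  · simpa [Prod.Lex.toLex_le_toLex] using hmin β ⟨hβ, h⟩
  · exact Or.inl (hα2.trans_lt (not_le.1 h))

theorem seriesVal_isLeast {ω : Fin n → ℝ} (hω : ∀ i, 0 < ω i) {f : MvPowerSeries (Fin n) ℂ}
    (hf : f ≠ 0) :
    IsLeast {r : ℝ | ∃ α : Fin n →₀ ℕ, MvPowerSeries.coeff α f ≠ 0 ∧ Finsupp.weight ω α = r}
      (seriesVal ω f) := by
  obtain ⟨α, hα, hmin⟩ := exists_lead hω hf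
  have h : IsLeast {r : ℝ | ∃ α : Fin n →₀ ℕ, MvPowerSeries.coeff α f ≠ 0 ∧
      Finsupp.weight ω α = r} (Finsupp.weight ω α) := by
    refine ⟨⟨α, hα, rfl⟩, ?_⟩
    rintro _ ⟨β, hβ, rfl⟩
    rcases hmin β hβ with h | h
    exacts [h.le, h.1.le]
  have h' : seriesVal ω f = Finsupp.weight ω α := h.csInf_eq
  rwa [h']

theorem seriesVal_eq {ω : Fin n → ℝ} {f : MvPowerSeries (Fin n) ℂ} {α : Fin n →₀ ℕ}
    (hα : MvPowerSeries.coeff α f ≠ 0)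
    (hmin : ∀ β, MvPowerSeries.coeff β f ≠ 0 → Finsupp.weight ω α ≤ Finsupp.weight ω β) :
    seriesVal ω f = Finsupp.weight ω α := by
  refine IsLeast.csInf_eq ⟨⟨α, hα, rfl⟩, ?_⟩
  rintro _ ⟨β, hβ, rfl⟩
  exact hmin β hβ

theorem seriesVal_mul {ω : Fin n → ℝ} (hω : ∀ i, 0 < ω i) {f g : MvPowerSeries (Fin n) ℂ}
    (hf : f ≠ 0) (hg : g ≠ 0) : seriesVal ω (f * g) = seriesVal ω f + seriesVal ω g := by
  classical
  obtain ⟨α, hα, hαm⟩ := exists_lead hω hf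
  obtain ⟨β, hβ, hβm⟩ := exists_lead hω hg
  have hα' : ∀ γ, MvPowerSeries.coeff γ f ≠ 0 → Finsupp.weight ω α ≤ Finsupp.weight ω γ :=
    fun γ h => (hαm γ h).elim le_of_lt fun h => h.1.le
  have hβ' : ∀ γ, MvPowerSeries.coeff γ g ≠ 0 → Finsupp.weight ω β ≤ Finsupp.weight ω γ :=
    fun γ h => (hβm γ h).elim le_of_lt fun h => h.1.le
  rw [seriesVal_eq hα hα', seriesVal_eq hβ hβ', ← map_add]
  apply seriesVal_eq
  · rw [MvPowerSeries.coeff_mul, Finset.sum_eq_single (α, β)]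
    · exact mul_ne_zero hα hβ
    · rintro ⟨γ, δ⟩ hγδ hne
      rw [Finset.HasAntidiagonal.mem_antidiagonal] at hγδ
      simp only at hγδ ⊢
      by_contra hnz
      have hγ : MvPowerSeries.coeff γ f ≠ 0 := left_ne_zero_of_mul hnz
      have hδ : MvPowerSeries.coeff δ g ≠ 0 := right_ne_zero_of_mul hnz
      have hw : Finsupp.weight ω γ + Finsupp.weight ω δ =
          Finsupp.weight ω α + Finsupp.weight ω β := by rw [← map_add, ← map_add, hγδ]
      have h1 := hα' γ hγ
      have h2 := hβ' δ hδ
      have l1 : toLex α ≤ toLex γ :=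
        (hαm γ hγ).elim (fun h => absurd h (by linarith)) fun h => h.2
      have l2 : toLex β ≤ toLex δ :=
        (hβm δ hδ).elim (fun h => absurd h (by linarith)) fun h => h.2
      have hs : toLex γ + toLex δ = toLex α + toLex β := by
        rw [← toLex_add, ← toLex_add, hγδ]
      have e1 : toLex γ = toLex α := by
        refine le_antisymm ?_ l1
        by_contra hlt
        exact absurd hs (add_lt_add_of_lt_of_le (not_le.1 hlt) l2).ne'
      have e1' : γ = α := toLex.injective e1
      subst e1'
      exact hne (by rw [add_left_cancel hγδ])
    · intro h
      simp at h
  · intro γ hγ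
    rw [MvPowerSeries.coeff_mul] at hγ
    obtain ⟨⟨δ, ε⟩, hδε, hnz⟩ := Finset.exists_ne_zero_of_sum_ne_zero hγ
    rw [Finset.HasAntidiagonal.mem_antidiagonal] at hδε
    simp only at hδε hnz
    rw [← hδε, map_add, map_add]
    exact add_le_add (hα' δ (left_ne_zero_of_mul hnz)) (hβ' ε (right_ne_zero_of_mul hnz))

theorem min_le_seriesVal_add {ω : Fin n → ℝ} (hω : ∀ i, 0 < ω i)
    {f g : MvPowerSeries (Fin n) ℂ} (hf : f ≠ 0) (hg : g ≠ 0) (hfg : f + g ≠ 0) :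
    min (seriesVal ω f) (seriesVal ω g) ≤ seriesVal ω (f + g) := by
  obtain ⟨⟨α, hα, hαw⟩, -⟩ := seriesVal_isLeast hω hfg
  rw [← hαw]
  rw [map_add] at hα
  by_cases h : MvPowerSeries.coeff α f = 0
  · rw [h, zero_add] at hα
    exact (min_le_right _ _).trans ((seriesVal_isLeast hω hg).2 ⟨α, hα, rfl⟩)
  · exact (min_le_left _ _).trans ((seriesVal_isLeast hω hf).2 ⟨α, h, rfl⟩)

theorem val_div {ω : Fin n → ℝ} (hω : ∀ i, 0 < ω i) {f g : MvPowerSeries (Fin n) ℂ}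
    (hf : f ≠ 0) (hg : g ≠ 0) :
    val ω (algebraMap _ (SeriesField n) f / algebraMap _ (SeriesField n) g) =
      seriesVal ω f - seriesVal ω g := by
  have hinj : Function.Injective (algebraMap (MvPowerSeries (Fin n) ℂ) (SeriesField n)) :=
    IsFractionRing.injective _ _
  have hf' := (map_ne_zero_iff _ hinj).2 hf
  have hg' := (map_ne_zero_iff _ hinj).2 hg
  set z := algebraMap _ (SeriesField n) f / algebraMap _ (SeriesField n) g with hz
  have hs := IsLocalization.sec_spec (nonZeroDivisors (MvPowerSeries (Fin n) ℂ)) z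
  unfold val
  set p := (IsLocalization.sec (nonZeroDivisors (MvPowerSeries (Fin n) ℂ)) z).1
  set q := (IsLocalization.sec (nonZeroDivisors (MvPowerSeries (Fin n) ℂ)) z).2
  have hq : (q : MvPowerSeries (Fin n) ℂ) ≠ 0 := nonZeroDivisors.coe_ne_zero q
  have hpq : f * q = p * g := by
    apply hinj
    rw [map_mul, map_mul, ← hs, hz]
    field_simp
  have hp : p ≠ 0 := by
    intro h
    rw [h, zero_mul] at hpq
    exact mul_ne_zero hf hq hpq
  have := congrArg (seriesVal ω) hpq
  rw [seriesVal_mul hω hf hq, seriesVal_mul hω hp hg] at this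
  linarith

theorem exists_div (z : SeriesField n) (hz : z ≠ 0) : ∃ f g : MvPowerSeries (Fin n) ℂ,
    f ≠ 0 ∧ g ≠ 0 ∧ z = algebraMap _ (SeriesField n) f / algebraMap _ (SeriesField n) g := by
  obtain ⟨f, g, hg, rfl⟩ := IsFractionRing.div_surjective (A := MvPowerSeries (Fin n) ℂ) z
  refine ⟨f, g, ?_, nonZeroDivisors.ne_zero hg, rfl⟩
  rintro rfl
  simp at hz

theorem val_mul {ω : Fin n → ℝ} (hω : ∀ i, 0 < ω i) {y z : SeriesField n}
    (hy : y ≠ 0) (hz : z ≠ 0) : val ω (y * z) = val ω y + val ω z := by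
  obtain ⟨f, g, hf, hg, rfl⟩ := exists_div y hy
  obtain ⟨p, q, hp, hq, rfl⟩ := exists_div z hz
  rw [div_mul_div_comm, ← map_mul, ← map_mul, val_div hω (mul_ne_zero hf hp) (mul_ne_zero hg hq),
    val_div hω hf hg, val_div hω hp hq, seriesVal_mul hω hf hp, seriesVal_mul hω hg hq]
  ring

theorem min_le_val_add {ω : Fin n → ℝ} (hω : ∀ i, 0 < ω i) {y z : SeriesField n}
    (hy : y ≠ 0) (hz : z ≠ 0) (hyz : y + z ≠ 0) :
    min (val ω y) (val ω z) ≤ val ω (y + z) := by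
  have hinj : Function.Injective (algebraMap (MvPowerSeries (Fin n) ℂ) (SeriesField n)) :=
    IsFractionRing.injective _ _
  obtain ⟨f, g, hf, hg, rfl⟩ := exists_div y hy
  obtain ⟨p, q, hp, hq, rfl⟩ := exists_div z hz
  have hg' := (map_ne_zero_iff _ hinj).2 hg
  have hq' := (map_ne_zero_iff _ hinj).2 hq
  rw [div_add_div _ _ hg' hq', ← map_mul, ← map_mul, ← map_mul, ← map_add] at hyz ⊢
  have hne : f * q + g * p ≠ 0 := by
    intro h
    rw [h] at hyz
    simp at hyz
  have := min_le_seriesVal_add hω (mul_ne_zero hf hq) (mul_ne_zero hg hp) hne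
  rw [val_div hω hne (mul_ne_zero hg hq), val_div hω hf hg, val_div hω hp hq]
  rw [seriesVal_mul hω hf hq, seriesVal_mul hω hg hp] at this
  rw [seriesVal_mul hω hg hq]
  rcases min_le_iff.1 this with h | h
  · exact min_le_iff.2 (Or.inl (by linarith))
  · exact min_le_iff.2 (Or.inr (by linarith))

open Classical in
/-- The absolute value `|z|_ω = e^{-ν_ω(z)}` on `ℂ((x))`, with `|0|_ω = 0`. -/
noncomputable def absVal (ω : Fin n → ℝ) (hω : ∀ i, 0 < ω i) :
    AbsoluteValue (SeriesField n) ℝ where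
  toFun z := if z = 0 then 0 else Real.exp (-val ω z)
  map_mul' y z := by
    by_cases hy : y = 0
    · simp [hy]
    by_cases hz : z = 0
    · simp [hz]
    simp only [mul_eq_zero, hy, hz, or_self, if_false]
    rw [val_mul hω hy hz, ← Real.exp_add, neg_add]
  nonneg' z := by
    by_cases hz : z = 0
    · simp [hz]
    · simp [hz, Real.exp_nonneg]
  eq_zero' z := by
    by_cases hz : z = 0
    · simp [hz]
    · simp [hz, Real.exp_ne_zero]
  add_le' y z := by
    by_cases hy : y = 0
    · simp [hy]
    by_cases hz : z = 0
    · simp [hz]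
    by_cases hyz : y + z = 0
    · simp only [hy, hz, hyz, if_true, if_false]
      positivity
    simp only [hy, hz, hyz, if_false]
    have h1 := Real.exp_pos (-val ω y)
    have h2 := Real.exp_pos (-val ω z)
    rcases min_le_iff.1 (min_le_val_add hω hy hz hyz) with h | h
    · have := Real.exp_le_exp.2 (neg_le_neg h)
      linarith
    · have := Real.exp_le_exp.2 (neg_le_neg h)
      linarith

/-- The completion of `ℂ((x))` with respect to `|·|_ω`. -/
abbrev CompletedField (ω : Fin n → ℝ) (hω : ∀ i, 0 < ω i) : Type :=
  (absVal ω hω).Completion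

end WeightedSeries

/-! Fix a nonzero homogeneous `a`. Call the order `m` of a quotient `b / a ^ m`, with `b`
homogeneous, its pole. The point is that the poles occurring in `ξ` grow at most linearly with the
weight: for a suitable `a`, the part of weight `ℓ` has order at most `A * ℓ + B`. Such elements form
the closed group `F.series A B`. Since nonzero homogeneous parts of different weights cannot cancel
in an ultrametric norm, limits still have homogeneous parts (`exists_hasSum`). A natural number `N`
that bounds `A` and `A * ℓ₀ + B` then makes `a ^ N` the required denominator.

A power series is its initial form `a` times `1 + u` with `u` small, so a geometric series gives
linear growth for its inverse (`exists_inv_mem_series`). A common denominator handles finitely many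
elements of `ℂ((x))` with one `a`.

For algebraic `ξ`, take `y` in `ℂ((x))` close to `ξ` and expand the minimal polynomial at `y`.
Characteristic zero makes the linear coefficient nonzero, so `η = ξ - y` is a fixed point of a
contraction `x ↦ c₀ + ∑ c k * x ^ (k + 2)` (`exists_hensel_equation`). Raising the slope `A` lowers
the constant `B` of elements of positive weight (`mem_series_of_norm_le`). A steep enough slope
yields a group `F.series A' B'` stable under the contraction, hence containing `η`
(`exists_mem_series_of_root`). -/

namespace WeightedSeries

open Filter Topology

/-! ### Groups of series with linearly growing poles -/

/-- Additive subgroups `piece ℓ t` of a normed field, whose nonzero elements are homogeneous of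
weight `ℓ`, the real number `t` bounding the order of their poles. -/
structure PoleFiltration (L : Type*) [NormedField L] where
  /-- The elements of weight `ℓ` with a pole of order at most `t`. -/
  piece : ℝ → ℝ → AddSubgroup L
  norm_eq : ∀ {ℓ t : ℝ} {x : L}, x ∈ piece ℓ t → x ≠ 0 → ‖x‖ = Real.exp (-ℓ)
  mono : ∀ {ℓ t t' : ℝ}, t ≤ t' → piece ℓ t ≤ piece ℓ t'
  mul_mem : ∀ {ℓ ℓ' t t' : ℝ} {x y : L}, x ∈ piece ℓ t → y ∈ piece ℓ' t' →
    x * y ∈ piece (ℓ + ℓ') (t + t')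
  one_mem : 1 ∈ piece 0 0

namespace PoleFiltration

variable {L : Type*} [NormedField L] (F : PoleFiltration L)

/-- Finite sums of homogeneous elements whose poles are bounded by `A * ℓ + B`. -/
def finiteSums (A B : ℝ) : AddSubgroup L := ⨆ ℓ : ℝ, F.piece ℓ (A * ℓ + B)

/-- Limits of finite sums of homogeneous elements whose poles are bounded by `A * ℓ + B`. -/
def series (A B : ℝ) : AddSubgroup L := (F.finiteSums A B).topologicalClosure

variable {F} {A A' B B' ℓ r : ℝ} {x y z : L}

theorem mem_finiteSums_of_piece (hx : x ∈ F.piece ℓ (A * ℓ + B)) : x ∈ F.finiteSums A B :=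
  AddSubgroup.mem_iSup_of_mem ℓ hx

theorem finiteSums_le_series : F.finiteSums A B ≤ F.series A B :=
  AddSubgroup.le_topologicalClosure _

theorem isClosed_series : IsClosed (F.series A B : Set L) :=
  AddSubgroup.isClosed_topologicalClosure _

theorem mem_series_of_piece (hx : x ∈ F.piece ℓ (A * ℓ + B)) : x ∈ F.series A B :=
  finiteSums_le_series (mem_finiteSums_of_piece hx)

theorem exists_finsupp (hx : x ∈ F.finiteSums A B) : ∃ h : ℝ →₀ L,
    (∀ ℓ, h ℓ ∈ F.piece ℓ (A * ℓ + B)) ∧ h.sum (fun _ y => y) = x := by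
  classical
  induction hx using AddSubgroup.iSup_induction' with
  | hp ℓ x hx =>
    refine ⟨Finsupp.single ℓ x, fun ℓ' => ?_, by simp⟩
    by_cases h : ℓ = ℓ'
    · subst h; simpa using hx
    · rw [Finsupp.single_eq_of_ne (Ne.symm h)]; exact zero_mem _
  | h1 => exact ⟨0, fun _ => zero_mem _, by simp⟩
  | hadd x y _ _ ihx ihy =>
    obtain ⟨h, hh, rfl⟩ := ihx
    obtain ⟨k, hk, rfl⟩ := ihy
    exact ⟨h + k, fun ℓ => add_mem (hh ℓ) (hk ℓ),
      Finsupp.sum_add_index' (fun _ => rfl) (fun _ _ _ => rfl)⟩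

theorem series_mono_right (hB : B ≤ B') : F.series A B ≤ F.series A B' :=
  AddSubgroup.topologicalClosure_minimal _
    (iSup_le fun _ _ hx => mem_series_of_piece (F.mono (by linarith) hx)) isClosed_series

theorem one_mem_series (hB : 0 ≤ B) : 1 ∈ F.series A B :=
  mem_series_of_piece (F.mono (by simpa using hB) F.one_mem)

/-- Weights and orders both add, so at a common slope `A` only the constants add. -/
theorem mul_mem_finiteSums (hx : x ∈ F.finiteSums A B) (hy : y ∈ F.finiteSums A B') :
    x * y ∈ F.finiteSums A (B + B') := by
  induction hx using AddSubgroup.iSup_induction' with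
  | hp ℓ x hx =>
    induction hy using AddSubgroup.iSup_induction' with
    | hp ℓ' y hy =>
      exact mem_finiteSums_of_piece (F.mono (le_of_eq (by ring)) (F.mul_mem hx hy))
    | h1 => simp
    | hadd y y' _ _ h h' => rw [mul_add]; exact add_mem h h'
  | h1 => simp
  | hadd x x' _ _ h h' => rw [add_mul]; exact add_mem h h'

theorem mul_mem_series (hx : x ∈ F.series A B) (hy : y ∈ F.series A B') :
    x * y ∈ F.series A (B + B') :=
  map_mem_closure₂ continuous_mul hx hy fun _ ha _ hb => mul_mem_finiteSums ha hb

theorem pow_mem_series (hx : x ∈ F.series A B) (k : ℕ) : x ^ k ∈ F.series A (k * B) := by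
  induction k with
  | zero => simpa using one_mem_series le_rfl
  | succ k ih =>
    rw [pow_succ, Nat.cast_succ, add_mul, one_mul]
    exact mul_mem_series ih hx

theorem exists_norm_sub_le (hx : x ∈ F.series A B) {ε : ℝ} (hε : 0 < ε) :
    ∃ y ∈ F.finiteSums A B, ‖x - y‖ ≤ ε := by
  obtain ⟨y, hy, h⟩ := Metric.mem_closure_iff.1 hx ε hε
  exact ⟨y, hy, by rw [← dist_eq_norm]; exact h.le⟩

/-- The inverse of `1 + x`, for `x` small, is a geometric series. -/
theorem inv_one_add_mem_series (hx : x ∈ F.series A 0) (h1 : ‖x‖ < 1) :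
    (1 + x)⁻¹ ∈ F.series A 0 := by
  have h := (hasSum_geometric_of_norm_lt_one (ξ := -x) (by rwa [norm_neg])).tendsto_sum_nat
  rw [sub_neg_eq_add] at h
  refine isClosed_series.mem_of_tendsto h (Eventually.of_forall fun m => ?_)
  refine sum_mem fun k _ => ?_
  -- The constant of the `k`-th power is `k * 0 = 0`, uniformly in `k`.
  simpa using pow_mem_series (neg_mem hx) k

/-! ### Ultrametric estimates and homogeneous expansions -/

variable [IsUltrametricDist L]

theorem norm_add_le_of_le (hx : ‖x‖ ≤ r) (hy : ‖y‖ ≤ r) : ‖x + y‖ ≤ r :=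
  (IsUltrametricDist.norm_add_le_max x y).trans (max_le hx hy)

theorem norm_sub_le_of_le (hx : ‖x‖ ≤ r) (hy : ‖y‖ ≤ r) : ‖x - y‖ ≤ r := by
  rw [sub_eq_add_neg]
  exact norm_add_le_of_le hx (by rwa [norm_neg])

theorem norm_sum_le_of_le {ι : Type*} {s : Finset ι} {f : ι → L} (hr : 0 ≤ r)
    (h : ∀ i ∈ s, ‖f i‖ ≤ r) : ‖∑ i ∈ s, f i‖ ≤ r :=
  Finset.sum_induction f (fun x => ‖x‖ ≤ r) (fun _ _ => norm_add_le_of_le) (by simpa) h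

/-- Homogeneous elements of different weights do not cancel. -/
theorem norm_le_norm_sum {h : ℝ →₀ L} (hh : ∀ ℓ, h ℓ ≠ 0 → ‖h ℓ‖ = Real.exp (-ℓ)) (ℓ : ℝ) :
    ‖h ℓ‖ ≤ ‖h.sum fun _ y => y‖ := by
  classical
  by_cases h0 : h ℓ = 0
  · simp [h0]
  have hne : h.support.Nonempty := ⟨ℓ, by simpa using h0⟩
  -- The term of least weight is strictly larger in norm than the sum of all the others, so it
  -- determines the norm of the whole sum.
  set m := h.support.min' hne with hm
  have hmem : m ∈ h.support := h.support.min'_mem hne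
  have hmin : ∀ k ∈ h.support, m ≤ k := fun k hk => h.support.min'_le k hk
  have hm0 := hh m (by simpa using hmem)
  have hle : ‖h ℓ‖ ≤ ‖h m‖ := by
    rw [hh ℓ h0, hm0]
    exact Real.exp_le_exp.2 (neg_le_neg (hmin ℓ (by simpa using h0)))
  refine hle.trans ?_
  rw [Finsupp.sum, ← Finset.add_sum_erase _ _ hmem]
  have hlt : ‖∑ k ∈ h.support.erase m, h k‖ < ‖h m‖ := by
    refine Finset.sum_induction h (fun x => ‖x‖ < ‖h m‖)
      (fun x y hx hy => (IsUltrametricDist.norm_add_le_max x y).trans_lt (max_lt hx hy))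
      (by rw [norm_zero, hm0]; exact Real.exp_pos _) fun k hk => ?_
    obtain ⟨hk1, hk2⟩ := Finset.mem_erase.1 hk
    rw [hm0, hh k (by simpa using hk2)]
    exact Real.exp_lt_exp.2 (neg_lt_neg (lt_of_le_of_ne (hmin k hk2) (Ne.symm hk1)))
  rw [IsUltrametricDist.norm_add_eq_max_of_norm_ne_norm hlt.ne']
  exact le_max_left _ _

/-- The smaller an element is, the more the constant `B` improves when `A` is enlarged. -/
theorem mem_series_of_norm_le (hx : x ∈ F.series A B) {w : ℝ} (hw : ‖x‖ ≤ Real.exp (-w))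
    (hA : A ≤ A') (hB : B - (A' - A) * w ≤ B') : x ∈ F.series A' B' := by
  refine Metric.mem_closure_iff.2 fun ε hε => ?_
  -- The approximation is also within `e^{-w}`, so `y` inherits the norm bound and all its nonzero
  -- homogeneous parts have weight at least `w`.
  obtain ⟨y, hy, hxy⟩ := exists_norm_sub_le hx (lt_min (half_pos hε) (Real.exp_pos (-w)))
  refine ⟨y, ?_, ?_⟩
  · have hyw : ‖y‖ ≤ Real.exp (-w) := by
      rw [← sub_sub_cancel x y]
      exact norm_sub_le_of_le hw (hxy.trans (min_le_right _ _))
    obtain ⟨h, hh, rfl⟩ := exists_finsupp hy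
    refine sum_mem fun ℓ _ => ?_
    by_cases h0 : h ℓ = 0
    · simp only [h0]; exact zero_mem _
    · have h1 := (norm_le_norm_sum (fun k hk => F.norm_eq (hh k) hk) ℓ).trans hyw
      rw [F.norm_eq (hh ℓ) h0, Real.exp_le_exp, neg_le_neg_iff] at h1
      refine mem_finiteSums_of_piece (F.mono ?_ (hh ℓ))
      nlinarith [mul_le_mul_of_nonneg_left h1 (sub_nonneg.2 hA)]
  · rw [dist_eq_norm]
    exact (hxy.trans (min_le_left _ _)).trans_lt (half_lt_self hε)

/-- Every element has some lower bound on its weights, possibly negative, so a larger slope only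
costs a change of constant. -/
theorem exists_mem_series_of_le (hx : x ∈ F.series A B) (hA : A ≤ A') :
    ∃ B', x ∈ F.series A' B' := by
  refine ⟨_, mem_series_of_norm_le (w := -Real.log (max ‖x‖ 1)) hx ?_ hA le_rfl⟩
  rw [neg_neg, Real.exp_log (by positivity)]
  exact le_max_left _ _

/-- Elements of `F.series A B` are sums of homogeneous elements. -/
theorem exists_hasSum (hx : x ∈ F.series A B) : ∃ h : ℝ → L,
    (∀ ℓ, h ℓ ∈ F.piece ℓ (A * ℓ + B)) ∧ (∀ ℓ, ‖h ℓ‖ ≤ ‖x‖) ∧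
      (∀ r : ℝ, {ℓ : ℝ | ℓ ≤ r ∧ h ℓ ≠ 0}.Finite) ∧ HasSum h x := by
  classical
  have hex : ∀ k : ℕ, ∃ h : ℝ →₀ L, (∀ ℓ, h ℓ ∈ F.piece ℓ (A * ℓ + B)) ∧
      ‖x - h.sum fun _ y => y‖ ≤ Real.exp (-k) := fun k => by
    obtain ⟨y, hy, hxy⟩ := exists_norm_sub_le hx (Real.exp_pos (-k))
    obtain ⟨h, hh, rfl⟩ := exists_finsupp hy
    exact ⟨h, hh, hxy⟩
  choose g hg hgx using hex
  -- The two approximations differ by at most `e^{-j}`, whereas a discrepancy in weight `ℓ < j`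
  -- would have norm `e^{-ℓ} > e^{-j}`.
  have hstab : ∀ {j k : ℕ} {ℓ : ℝ}, j ≤ k → ℓ < j → g j ℓ = g k ℓ := by
    intro j k ℓ hjk hℓ
    by_contra hne
    have hmem : ∀ ℓ, (g j - g k) ℓ ∈ F.piece ℓ (A * ℓ + B) := fun ℓ => sub_mem (hg j ℓ) (hg k ℓ)
    have h1 := norm_le_norm_sum (h := g j - g k) (fun k hk => F.norm_eq (hmem k) hk) ℓ
    rw [F.norm_eq (hmem ℓ) (by simpa [sub_eq_zero] using hne),
      Finsupp.sum_sub_index (fun _ _ _ => rfl)] at h1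
    have h2 : ‖(g j).sum (fun _ y => y) - (g k).sum (fun _ y => y)‖ ≤ Real.exp (-j) := by
      rw [← sub_sub_sub_cancel_left _ _ x]
      refine norm_sub_le_of_le ((hgx k).trans (Real.exp_le_exp.2 ?_)) (hgx j)
      exact neg_le_neg (by exact_mod_cast hjk)
    have h3 := Real.exp_le_exp.1 (h1.trans h2)
    linarith
  -- The index `⌊ℓ⌋₊ + 1` is a natural number exceeding `ℓ`, so the part of weight `ℓ` is already
  -- stable there. For negative `ℓ` the index is `1`.
  set h : ℝ → L := fun ℓ => g (⌊ℓ⌋₊ + 1) ℓ with hdef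
  have hgh : ∀ {k : ℕ} {ℓ : ℝ}, ℓ < k → h ℓ = g k ℓ := by
    intro k ℓ hℓ
    rcases le_or_gt ℓ 0 with h0 | h0
    · have hf : ⌊ℓ⌋₊ = 0 := Nat.floor_of_nonpos h0
      simp only [hdef, hf, zero_add]
      rcases Nat.eq_zero_or_pos k with rfl | hk
      · exact (hstab (Nat.zero_le 1) hℓ).symm
      · exact hstab hk (by push_cast; linarith)
    · exact hstab (Nat.succ_le_of_lt ((Nat.floor_lt h0.le).2 hℓ))
        (by push_cast; exact Nat.lt_floor_add_one ℓ)
  have hfin : ∀ r : ℝ, {ℓ : ℝ | ℓ ≤ r ∧ h ℓ ≠ 0}.Finite := by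
    intro r
    obtain ⟨k, hk⟩ := exists_nat_gt r
    refine (g k).support.finite_toSet.subset fun ℓ hℓ => ?_
    simpa [← hgh (hℓ.1.trans_lt hk)] using hℓ.2
  have hpiece : ∀ ℓ, h ℓ ∈ F.piece ℓ (A * ℓ + B) := fun ℓ => hg _ ℓ
  have hsum : HasSum h x := by
    rw [HasSum, SummationFilter.unconditional_filter, Metric.tendsto_atTop]
    intro ε hε
    obtain ⟨k, hk⟩ := exists_nat_gt (-Real.log ε)
    have hkε : Real.exp (-k) < ε := by
      rw [← Real.exp_log hε]; exact Real.exp_lt_exp.2 (by linarith)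
    refine ⟨(g k).support, fun s hs => lt_of_le_of_lt ?_ hkε⟩
    rw [dist_eq_norm, norm_sub_rev]
    -- The correction terms vanish for weights below `k`, and the remaining ones have norm at most
    -- `e^{-k}`.
    have hsplit : x - ∑ ℓ ∈ s, h ℓ = (x - (g k).sum fun _ y => y) - ∑ ℓ ∈ s, (h ℓ - g k ℓ) := by
      rw [Finset.sum_sub_distrib, Finsupp.sum_of_support_subset _ hs _ (fun _ _ => rfl)]
      abel
    rw [hsplit]
    refine norm_sub_le_of_le (hgx k) (norm_sum_le_of_le (Real.exp_pos _).le fun ℓ _ => ?_)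
    rcases lt_or_ge ℓ k with hℓ | hℓ
    · rw [hgh hℓ, sub_self, norm_zero]; exact (Real.exp_pos _).le
    · by_cases h0 : h ℓ - g k ℓ = 0
      · rw [h0, norm_zero]; exact (Real.exp_pos _).le
      · rw [F.norm_eq (sub_mem (hpiece ℓ) (hg k ℓ)) h0]
        exact Real.exp_le_exp.2 (neg_le_neg hℓ)
  refine ⟨h, hpiece, fun ℓ => ?_, hfin, hsum⟩
  by_cases h0 : h ℓ = 0
  · rw [h0, norm_zero]; exact norm_nonneg x
  obtain ⟨k, hk⟩ := exists_nat_gt ℓ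
  have hle : ‖h ℓ‖ ≤ max ‖x‖ (Real.exp (-k)) := by
    rw [hgh hk]
    refine (norm_le_norm_sum (fun k' hk' => F.norm_eq (hg k k') hk') ℓ).trans ?_
    rw [← sub_sub_cancel x (Finsupp.sum _ _)]
    exact norm_sub_le_of_le (le_max_left _ _) ((hgx k).trans (le_max_right _ _))
  -- The second case is impossible, as `ℓ < k` gives `‖h ℓ‖ = e^{-ℓ} > e^{-k}`.
  rcases le_max_iff.1 hle with hle | hle
  · exact hle
  · rw [F.norm_eq (hpiece ℓ) h0] at hle
    have := Real.exp_le_exp.1 hle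
    linarith

/-! ### Small roots of Hensel equations -/

/-- Exponents of at least two leave a spare factor of size `r` beside `x - y`. This factor absorbs
the coefficients and makes the Hensel map contracting. -/
theorem norm_pow_sub_pow_le (hr : r ≤ 1) (hx : ‖x‖ ≤ r) (hy : ‖y‖ ≤ r) (k : ℕ) :
    ‖x ^ (k + 2) - y ^ (k + 2)‖ ≤ r * ‖x - y‖ := by
  have hr0 : 0 ≤ r := (norm_nonneg x).trans hx
  have hstep : ∀ m : ℕ, ‖x ^ (m + 1) - y ^ (m + 1)‖ ≤ ‖x - y‖ := by
    intro m
    induction m with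
    | zero => simp
    | succ m ih =>
      have e : x ^ (m + 1 + 1) - y ^ (m + 1 + 1) =
          x ^ (m + 1) * (x - y) + (x ^ (m + 1) - y ^ (m + 1)) * y := by ring
      rw [e]
      refine norm_add_le_of_le ?_ ?_
      · rw [norm_mul, norm_pow]
        exact mul_le_of_le_one_left (norm_nonneg _) (pow_le_one₀ (norm_nonneg _) (hx.trans hr))
      · rw [norm_mul]
        exact (mul_le_of_le_one_right (norm_nonneg _) (hy.trans hr)).trans ih
  have e : x ^ (k + 2) - y ^ (k + 2) =
      x ^ (k + 1) * (x - y) + (x ^ (k + 1) - y ^ (k + 1)) * y := by ring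
  rw [e]
  refine norm_add_le_of_le ?_ ?_
  · rw [norm_mul, norm_pow]
    refine mul_le_mul_of_nonneg_right ?_ (norm_nonneg _)
    exact (pow_le_of_le_one (norm_nonneg _) (hx.trans hr) (Nat.succ_ne_zero k)).trans hx
  · rw [norm_mul, mul_comm]
    exact mul_le_mul hy (hstep k) (norm_nonneg _) hr0

/-- A small root of an equation of Hensel type has linearly growing poles if the coefficients of
the equation have. -/
theorem exists_mem_series_of_root {N : ℕ} {c₀ η : L} {c : ℕ → L} {M w : ℝ}
    (hη : η = c₀ + ∑ k ∈ Finset.range N, c k * η ^ (k + 2))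
    (hB : 0 ≤ B) (hc₀ : c₀ ∈ F.series A B) (hc : ∀ k < N, c k ∈ F.series A B)
    (hM : 0 ≤ M) (hMw : M < w) (hcM : ∀ k < N, ‖c k‖ ≤ Real.exp M) (hηw : ‖η‖ ≤ Real.exp (-w)) :
    ∃ A' B', A ≤ A' ∧ η ∈ F.series A' B' := by
  set r := Real.exp (-w) with hr
  have hr0 : 0 < r := Real.exp_pos _
  have hr1 : r ≤ 1 := Real.exp_le_one_iff.2 (by linarith)
  have hMr : Real.exp M * r < 1 := by
    rw [hr, ← Real.exp_add, Real.exp_lt_one_iff]; linarith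
  have hterm : ∀ k < N, ∀ x y : L, ‖x‖ ≤ r → ‖y‖ ≤ r →
      ‖c k * x ^ (k + 2) - c k * y ^ (k + 2)‖ ≤ Real.exp M * r * ‖x - y‖ := by
    intro k hk x y hx hy
    rw [← mul_sub, norm_mul, mul_assoc]
    exact mul_le_mul (hcM k hk) (norm_pow_sub_pow_le hr1 hx hy k) (norm_nonneg _)
      (Real.exp_pos _).le
  have hsum : ∀ x : L, ‖x‖ ≤ r → ‖∑ k ∈ Finset.range N, c k * x ^ (k + 2)‖ ≤ r := by
    refine fun x hx => norm_sum_le_of_le hr0.le fun k hk => ?_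
    have := hterm k (Finset.mem_range.1 hk) x 0 hx (by simpa using hr0.le)
    simp only [ne_eq, Nat.add_eq_zero_iff, OfNat.ofNat_ne_zero, and_false, not_false_eq_true,
      zero_pow, mul_zero, sub_zero] at this
    exact this.trans ((mul_le_of_le_one_left (norm_nonneg _) hMr.le).trans hx)
  have hc₀r : ‖c₀‖ ≤ r := by
    rw [← add_sub_cancel_right c₀ (∑ k ∈ Finset.range N, c k * η ^ (k + 2)), ← hη]
    exact norm_sub_le_of_le hηw (hsum η hηw)
  -- With slope `A + e`, the constant of `c₀` (weights at least `w`) drops to `B - e * w`, and that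
  -- of each `c k` (weights at least `-M`) rises to `D = B + e * M`. The value of `e` solves `B - e
  -- * w = -D`.
  set e := 2 * B / (w - M) with he
  have he0 : 0 ≤ e := div_nonneg (by linarith) (by linarith)
  have heq : e * (w - M) = 2 * B := div_mul_cancel₀ _ (by linarith)
  set D := B + e * M with hD
  have hD0 : 0 ≤ D := by positivity
  have hc₀' : c₀ ∈ F.series (A + e) (-D) :=
    mem_series_of_norm_le hc₀ hc₀r (by linarith) (by rw [hD]; nlinarith)
  have hc' : ∀ k < N, c k ∈ F.series (A + e) D := fun k hk =>
    mem_series_of_norm_le (w := -M) (hc k hk) (by simpa using hcM k hk) (by linarith)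
      (by rw [hD]; nlinarith)
  set Φ : L → L := fun x => c₀ + ∑ k ∈ Finset.range N, c k * x ^ (k + 2) with hΦ
  have hΦη : Φ η = η := hη.symm
  set z : ℕ → L := fun j => Φ^[j] 0 with hz
  have hzs : ∀ j, z (j + 1) = Φ (z j) := fun j => Function.iterate_succ_apply' _ _ _
  have hzr : ∀ j, ‖z j‖ ≤ r := by
    intro j
    induction j with
    | zero => simpa [hz] using hr0.le
    | succ j ih => rw [hzs]; exact norm_add_le_of_le hc₀r (hsum _ ih)
  have hzS : ∀ j, z j ∈ F.series (A + e) (-D) := by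
    intro j
    induction j with
    | zero => simp [hz]
    | succ j ih =>
      rw [hzs]
      refine add_mem hc₀' (sum_mem fun k hk => ?_)
      -- The constant of `c k * x ^ (k + 2)` is `D - (k + 2) * D`, at most `-D` because `D ≥ 0`.
      refine series_mono_right ?_
        (mul_mem_series (hc' k (Finset.mem_range.1 hk)) (pow_mem_series ih (k + 2)))
      push_cast
      nlinarith [mul_nonneg (Nat.cast_nonneg (α := ℝ) k) hD0]
  have hconv : ∀ j, ‖η - z j‖ ≤ (Real.exp M * r) ^ j * r := by
    intro j
    induction j with
    | zero => simpa [hz] using hηw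
    | succ j ih =>
      have e1 : η - z (j + 1) =
          ∑ k ∈ Finset.range N, (c k * η ^ (k + 2) - c k * z j ^ (k + 2)) := by
        rw [hzs, Finset.sum_sub_distrib]
        nth_rewrite 1 [hη]
        simp only [hΦ]
        ring
      rw [e1, pow_succ', mul_assoc]
      refine norm_sum_le_of_le (by positivity) fun k hk => ?_
      exact (hterm k (Finset.mem_range.1 hk) _ _ hηw (hzr j)).trans
        (mul_le_mul_of_nonneg_left ih (by positivity))
  refine ⟨A + e, -D, by linarith, isClosed_series.mem_of_tendsto (f := z) (b := atTop) ?_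
    (Eventually.of_forall hzS)⟩
  rw [tendsto_iff_norm_sub_tendsto_zero]
  have hlim := (tendsto_pow_atTop_nhds_zero_of_lt_one (by positivity) hMr).mul_const r
  rw [zero_mul] at hlim
  exact squeeze_zero (fun _ => norm_nonneg _)
    (fun j => by rw [norm_sub_rev]; exact hconv j) hlim

end PoleFiltration

/-! ### The completion as an ultrametric field -/

section Completion

variable {n : ℕ} {ω : Fin n → ℝ} {hω : ∀ i, 0 < ω i}

theorem algebraMap_completedField (z : SeriesField n) :
    algebraMap (SeriesField n) (CompletedField ω hω) z =
      ((WithAbs.toAbs (absVal ω hω) z : WithAbs (absVal ω hω)) : CompletedField ω hω) := rfl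

theorem norm_algebraMap_completedField (z : SeriesField n) :
    ‖algebraMap (SeriesField n) (CompletedField ω hω) z‖ = absVal ω hω z := by
  rw [algebraMap_completedField, UniformSpace.Completion.norm_coe, WithAbs.norm_toAbs_eq]

theorem denseRange_algebraMap :
    DenseRange (algebraMap (SeriesField n) (CompletedField ω hω)) :=
  UniformSpace.Completion.denseRange_coe.comp (WithAbs.toAbs_surjective _).denseRange
    (UniformSpace.Completion.continuous_coe _)

theorem absVal_of_ne_zero {z : SeriesField n} (hz : z ≠ 0) :
    absVal ω hω z = Real.exp (-val ω z) := if_neg hz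

theorem absVal_add_le_max (y z : SeriesField n) :
    absVal ω hω (y + z) ≤ max (absVal ω hω y) (absVal ω hω z) := by
  by_cases hy : y = 0
  · simp [hy]
  by_cases hz : z = 0
  · simp [hz]
  by_cases hyz : y + z = 0
  · rw [hyz, map_zero]; exact le_max_of_le_left ((absVal ω hω).nonneg y)
  rw [absVal_of_ne_zero hy, absVal_of_ne_zero hz, absVal_of_ne_zero hyz]
  rcases min_le_iff.1 (min_le_val_add hω hy hz hyz) with h | h
  · exact le_max_of_le_left (Real.exp_le_exp.2 (neg_le_neg h))
  · exact le_max_of_le_right (Real.exp_le_exp.2 (neg_le_neg h))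

instance isUltrametricDist_completedField : IsUltrametricDist (CompletedField ω hω) := by
  refine IsUltrametricDist.isUltrametricDist_of_forall_norm_add_le_max_norm fun x y => ?_
  refine denseRange_algebraMap.induction_on₂
    (p := fun x y : CompletedField ω hω => ‖x + y‖ ≤ max ‖x‖ ‖y‖) ?_ ?_ x y
  · exact isClosed_le (by fun_prop) (by fun_prop)
  · intro y z
    rw [← map_add]
    simp only [norm_algebraMap_completedField]
    exact absVal_add_le_max y z

variable (hω)

/-- A power series viewed as an element of the completion. -/
noncomputable def seriesHom : MvPowerSeries (Fin n) ℂ →+* CompletedField ω hω :=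
  (algebraMap (SeriesField n) (CompletedField ω hω)).comp
    (algebraMap (MvPowerSeries (Fin n) ℂ) (SeriesField n))

/-- A polynomial viewed as an element of the completion. -/
noncomputable def polyHom : MvPolynomial (Fin n) ℂ →+* CompletedField ω hω :=
  (seriesHom hω).comp MvPolynomial.coeToMvPowerSeries.ringHom

theorem polyHom_apply (p : MvPolynomial (Fin n) ℂ) :
    polyHom hω p = seriesHom hω (p : MvPowerSeries (Fin n) ℂ) := rfl

theorem algebraMap_series_ne_zero {f : MvPowerSeries (Fin n) ℂ} (hf : f ≠ 0) :
    algebraMap (MvPowerSeries (Fin n) ℂ) (SeriesField n) f ≠ 0 :=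
  (map_ne_zero_iff _ (IsFractionRing.injective _ _)).2 hf

theorem seriesHom_ne_zero {f : MvPowerSeries (Fin n) ℂ} (hf : f ≠ 0) : seriesHom hω f ≠ 0 :=
  (map_ne_zero_iff _ (algebraMap (SeriesField n) (CompletedField ω hω)).injective).2
    (algebraMap_series_ne_zero hf)

theorem coe_poly_ne_zero {p : MvPolynomial (Fin n) ℂ} (hp : p ≠ 0) :
    (p : MvPowerSeries (Fin n) ℂ) ≠ 0 := by
  rwa [Ne, MvPolynomial.coe_eq_zero_iff]

theorem polyHom_ne_zero {p : MvPolynomial (Fin n) ℂ} (hp : p ≠ 0) : polyHom hω p ≠ 0 :=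
  seriesHom_ne_zero hω (coe_poly_ne_zero hp)

theorem seriesVal_one : seriesVal ω (1 : MvPowerSeries (Fin n) ℂ) = 0 := by
  classical
  rw [seriesVal_eq (α := 0) (by simp) fun β hβ => ?_, map_zero]
  rw [MvPowerSeries.coeff_one] at hβ
  rw [show β = 0 by by_contra h; simp [h] at hβ]

theorem norm_seriesHom {f : MvPowerSeries (Fin n) ℂ} (hf : f ≠ 0) :
    ‖seriesHom hω f‖ = Real.exp (-seriesVal ω f) := by
  have h := val_div hω hf (one_ne_zero (α := MvPowerSeries (Fin n) ℂ))
  rw [map_one, div_one, seriesVal_one, sub_zero] at h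
  rw [← h, ← absVal_of_ne_zero (hω := hω) (algebraMap_series_ne_zero hf), ← norm_algebraMap_completedField]
  rfl

theorem norm_seriesHom_le {f : MvPowerSeries (Fin n) ℂ} {r : ℝ}
    (h : ∀ α, MvPowerSeries.coeff α f ≠ 0 → r ≤ Finsupp.weight ω α) :
    ‖seriesHom hω f‖ ≤ Real.exp (-r) := by
  by_cases hf : f = 0
  · rw [hf, map_zero, norm_zero]; exact (Real.exp_pos _).le
  obtain ⟨⟨α, hα, hαw⟩, -⟩ := seriesVal_isLeast hω hf
  rw [norm_seriesHom hω hf, ← hαw]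
  exact Real.exp_le_exp.2 (neg_le_neg (h α hα))

theorem norm_polyHom {p : MvPolynomial (Fin n) ℂ} (hp : p ≠ 0) {w : ℝ}
    (hw : MvPolynomial.IsWeightedHomogeneous ω p w) : ‖polyHom hω p‖ = Real.exp (-w) := by
  have hp' := coe_poly_ne_zero hp
  obtain ⟨⟨α, hα, hαw⟩, -⟩ := seriesVal_isLeast hω hp'
  rw [MvPolynomial.coeff_coe] at hα
  rw [polyHom_apply, norm_seriesHom hω hp', ← hαw, hw hα]

theorem norm_polyHom_div {a b : MvPolynomial (Fin n) ℂ} {d ℓ : ℝ} {m : ℕ} (ha0 : a ≠ 0)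
    (ha : MvPolynomial.IsWeightedHomogeneous ω a d) (hb0 : b ≠ 0)
    (hb : MvPolynomial.IsWeightedHomogeneous ω b (ℓ + m * d)) :
    ‖polyHom hω b / polyHom hω a ^ m‖ = Real.exp (-ℓ) := by
  rw [norm_div, norm_pow, norm_polyHom hω ha0 ha, norm_polyHom hω hb0 hb, ← Real.exp_nat_mul,
    ← Real.exp_sub]
  congr 1
  ring

/-! ### Quotients by powers of a polynomial, and elements of `ℂ((x))` -/

/-- The quotients `b / a ^ m` with `b` homogeneous, graded by weight and filtered by `m`. -/
noncomputable def quotientFiltration {a : MvPolynomial (Fin n) ℂ} {d : ℝ} (ha0 : a ≠ 0)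
    (ha : MvPolynomial.IsWeightedHomogeneous ω a d) : PoleFiltration (CompletedField ω hω) where
  piece ℓ t :=
    { carrier := {x | x = 0 ∨ ∃ (m : ℕ) (b : MvPolynomial (Fin n) ℂ), (m : ℝ) ≤ t ∧
        MvPolynomial.IsWeightedHomogeneous ω b (ℓ + m * d) ∧
          x = polyHom hω b / polyHom hω a ^ m}
      zero_mem' := Or.inl rfl
      add_mem' := by
        have key : ∀ {m m' : ℕ} {b b' : MvPolynomial (Fin n) ℂ}, m ≤ m' →
            MvPolynomial.IsWeightedHomogeneous ω b (ℓ + m * d) →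
            MvPolynomial.IsWeightedHomogeneous ω b' (ℓ + m' * d) →
            ∃ c, MvPolynomial.IsWeightedHomogeneous ω c (ℓ + m' * d) ∧
              polyHom hω b / polyHom hω a ^ m + polyHom hω b' / polyHom hω a ^ m' =
                polyHom hω c / polyHom hω a ^ m' := by
          intro m m' b b' hmm hb hb'
          obtain ⟨k, rfl⟩ := Nat.exists_eq_add_of_le hmm
          refine ⟨b * a ^ k + b', (MvPolynomial.IsWeightedHomogeneous.add ?_ hb'), ?_⟩
          · convert hb.mul (ha.pow k) using 1
            push_cast
            rw [nsmul_eq_mul]; ring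
          · have := polyHom_ne_zero hω ha0
            rw [map_add, map_mul, map_pow]
            field_simp
            ring
        rintro x y (rfl | ⟨m, b, hm, hb, rfl⟩) hy
        · rwa [zero_add]
        rcases hy with rfl | ⟨m', b', hm', hb', rfl⟩
        · rw [add_zero]; exact Or.inr ⟨m, b, hm, hb, rfl⟩
        rcases le_total m m' with h | h
        · obtain ⟨c, hc, e⟩ := key h hb hb'
          exact Or.inr ⟨m', c, hm', hc, e⟩
        · obtain ⟨c, hc, e⟩ := key h hb' hb
          exact Or.inr ⟨m, c, hm, hc, by rw [add_comm, e]⟩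
      neg_mem' := by
        rintro x (rfl | ⟨m, b, hm, hb, rfl⟩)
        · exact Or.inl neg_zero
        · exact Or.inr ⟨m, -b, hm, hb.neg, by rw [map_neg, neg_div]⟩ }
  norm_eq := by
    rintro ℓ t x (rfl | ⟨m, b, hm, hb, rfl⟩) hx
    · exact absurd rfl hx
    · refine norm_polyHom_div hω ha0 ha ?_ hb
      rintro rfl
      simp at hx
  mono := by
    rintro ℓ t t' htt x (rfl | ⟨m, b, hm, hb, rfl⟩)
    · exact Or.inl rfl
    · exact Or.inr ⟨m, b, hm.trans htt, hb, rfl⟩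
  mul_mem := by
    rintro ℓ ℓ' t t' x y (rfl | ⟨m, b, hm, hb, rfl⟩) hy
    · exact Or.inl (zero_mul y)
    rcases hy with rfl | ⟨m', b', hm', hb', rfl⟩
    · exact Or.inl (mul_zero _)
    refine Or.inr ⟨m + m', b * b', by push_cast; linarith, ?_, ?_⟩
    · convert hb.mul hb' using 1
      push_cast
      ring
    · rw [map_mul, pow_add, div_mul_div_comm]
  one_mem := Or.inr ⟨0, 1, by simp, by simpa using MvPolynomial.isWeightedHomogeneous_one ℂ ω,
    by simp⟩

variable {hω}

theorem mem_quotientFiltration_piece {a : MvPolynomial (Fin n) ℂ} {d : ℝ} {ha0 : a ≠ 0}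
    {ha : MvPolynomial.IsWeightedHomogeneous ω a d} {ℓ t : ℝ} {x : CompletedField ω hω} :
    x ∈ (quotientFiltration hω ha0 ha).piece ℓ t ↔
      x = 0 ∨ ∃ (m : ℕ) (b : MvPolynomial (Fin n) ℂ), (m : ℝ) ≤ t ∧
        MvPolynomial.IsWeightedHomogeneous ω b (ℓ + m * d) ∧
          x = polyHom hω b / polyHom hω a ^ m := Iff.rfl

/-- The quotient is the limit of its truncations by weight, and each monomial over `a ^ m` is
homogeneous of weight `⟨ω, α⟩ - m * d`. -/
theorem seriesHom_div_mem_series {a : MvPolynomial (Fin n) ℂ} {d : ℝ} (ha0 : a ≠ 0)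
    (ha : MvPolynomial.IsWeightedHomogeneous ω a d) {A B : ℝ} {m : ℕ}
    {f : MvPowerSeries (Fin n) ℂ}
    (h : ∀ α, MvPowerSeries.coeff α f ≠ 0 → (m : ℝ) ≤ A * (Finsupp.weight ω α - m * d) + B) :
    seriesHom hω f / polyHom hω a ^ m ∈ (quotientFiltration hω ha0 ha).series A B := by
  classical
  have ha' := polyHom_ne_zero hω ha0
  set s : ℕ → Finset (Fin n →₀ ℕ) := fun k => (finite_weight_le hω (k : ℝ)).toFinset with hs
  set p : ℕ → MvPolynomial (Fin n) ℂ := fun k => MvPowerSeries.truncFinset ℂ (s k) f with hp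
  refine PoleFiltration.isClosed_series.mem_of_tendsto (b := atTop)
    (f := fun k => polyHom hω (p k) / polyHom hω a ^ m) ?_ (Eventually.of_forall fun k => ?_)
  · refine Tendsto.div_const ?_ _
    rw [tendsto_iff_norm_sub_tendsto_zero]
    have hlim : Tendsto (fun k : ℕ => Real.exp (-(k : ℝ))) atTop (𝓝 0) :=
      Real.tendsto_exp_neg_atTop_nhds_zero.comp tendsto_natCast_atTop_atTop
    refine squeeze_zero (fun _ => norm_nonneg _) (fun k => ?_) hlim
    rw [polyHom_apply, ← map_sub]
    refine norm_seriesHom_le hω fun α hα => ?_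
    by_contra! hlt
    have hmem : α ∈ s k := by simpa [hs] using hlt.le
    apply hα
    rw [map_sub, MvPolynomial.coeff_coe, hp, MvPowerSeries.coeff_truncFinset_of_mem f hmem,
      sub_self]
  · simp only [hp]
    rw [MvPowerSeries.truncFinset_apply, map_sum, Finset.sum_div]
    refine sum_mem fun α _ => ?_
    by_cases hα : MvPowerSeries.coeff α f = 0
    · simp [hα]
    · refine PoleFiltration.mem_series_of_piece (ℓ := Finsupp.weight ω α - m * d) ?_
      exact mem_quotientFiltration_piece.2 (Or.inr ⟨m, _, h α hα,
        MvPolynomial.isWeightedHomogeneous_monomial _ _ _ (by ring), rfl⟩)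

/-- The inverse of a power series has linearly growing poles along its initial form. -/
theorem exists_inv_mem_series {g : MvPowerSeries (Fin n) ℂ} (hg : g ≠ 0) :
    ∃ (a : MvPolynomial (Fin n) ℂ) (d : ℝ) (ha0 : a ≠ 0)
      (ha : MvPolynomial.IsWeightedHomogeneous ω a d) (A B : ℝ), 0 ≤ A ∧ 0 ≤ B ∧
        (seriesHom hω g)⁻¹ ∈ (quotientFiltration hω ha0 ha).series A B := by
  classical
  obtain ⟨⟨α, hα, hαw⟩, hmin⟩ := seriesVal_isLeast hω hg
  set d := seriesVal ω g with hd
  have hd0 : 0 ≤ d := by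
    rw [← hαw, Finsupp.weight_eq_sum]
    exact Finset.sum_nonneg fun i _ => nsmul_nonneg (hω i).le _
  set s : Finset (Fin n →₀ ℕ) :=
    (finite_weight_le hω d).toFinset.filter fun β => Finsupp.weight ω β = d with hs
  have hmem : ∀ β, β ∈ s ↔ Finsupp.weight ω β = d := fun β => by
    simp only [hs, Finset.mem_filter, Set.Finite.mem_toFinset, Set.mem_ofPred_eq]
    exact ⟨fun h => h.2, fun h => ⟨h.le, h⟩⟩
  -- This is the initial form of `g`, a polynomial because only finitely many exponents have weight
  -- `d`.
  set a := MvPowerSeries.truncFinset ℂ s g with haa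
  have ha0 : a ≠ 0 := by
    intro h
    have := MvPowerSeries.coeff_truncFinset_of_mem g ((hmem α).2 hαw)
    rw [← haa, h, MvPolynomial.coeff_zero] at this
    exact hα this.symm
  have ha : MvPolynomial.IsWeightedHomogeneous ω a d := fun β hβ =>
    (hmem β).1 (by by_contra h; exact hβ (MvPowerSeries.coeff_truncFinset_eq_zero g h))
  -- Weights are discrete, so there is a gap `δ` above the minimal weight.
  obtain ⟨δ, hδ, hgap⟩ : ∃ δ : ℝ, 0 < δ ∧
      ∀ β, d < Finsupp.weight ω β → d + δ ≤ Finsupp.weight ω β := by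
    have hfin : {β : Fin n →₀ ℕ | d < Finsupp.weight ω β ∧ Finsupp.weight ω β ≤ d + 1}.Finite :=
      (finite_weight_le hω (d + 1)).subset fun _ h => h.2
    rcases Set.eq_empty_or_nonempty
      {β : Fin n →₀ ℕ | d < Finsupp.weight ω β ∧ Finsupp.weight ω β ≤ d + 1} with he | hne
    · refine ⟨1, one_pos, fun β hβ => ?_⟩
      by_contra! hlt
      exact Set.eq_empty_iff_forall_notMem.1 he β ⟨hβ, hlt.le⟩
    · obtain ⟨γ, hγ, hγm⟩ := Set.exists_min_image _ (fun β => Finsupp.weight ω β) hfin hne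
      refine ⟨Finsupp.weight ω γ - d, sub_pos.2 hγ.1, fun β hβ => ?_⟩
      rw [add_sub_cancel]
      by_cases h : Finsupp.weight ω β ≤ d + 1
      · exact hγm β ⟨hβ, h⟩
      · exact hγ.2.trans (not_le.1 h).le
  have hrest : ∀ β, MvPowerSeries.coeff β (g - (a : MvPowerSeries (Fin n) ℂ)) ≠ 0 →
      d + δ ≤ Finsupp.weight ω β := by
    intro β hβ
    rw [map_sub, MvPolynomial.coeff_coe] at hβ
    by_cases h : β ∈ s
    · rw [haa, MvPowerSeries.coeff_truncFinset_of_mem g h, sub_self] at hβ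
      exact absurd rfl hβ
    · rw [haa, MvPowerSeries.coeff_truncFinset_eq_zero g h, sub_zero] at hβ
      exact hgap β (lt_of_le_of_ne (hmin ⟨β, hβ, rfl⟩) fun e => h ((hmem β).2 e.symm))
  set u := seriesHom hω (g - (a : MvPowerSeries (Fin n) ℂ)) / polyHom hω a ^ 1 with hu
  have ha' := polyHom_ne_zero hω ha0
  -- Every part of `u` has weight at least `δ` and order at most `1`, and `1 ≤ δ⁻¹ * ℓ` for `ℓ ≥ δ`.
  have huS : u ∈ (quotientFiltration hω ha0 ha).series δ⁻¹ 0 := by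
    refine seriesHom_div_mem_series ha0 ha fun β hβ => ?_
    have := hrest β hβ
    rw [add_zero, Nat.cast_one, one_mul, inv_mul_eq_div, one_le_div hδ]
    linarith
  have hu1 : ‖u‖ < 1 := by
    rw [hu, pow_one, norm_div, norm_polyHom hω ha0 ha, div_lt_one (Real.exp_pos _)]
    exact (norm_seriesHom_le hω hrest).trans_lt (Real.exp_lt_exp.2 (by linarith))
  have hgu : seriesHom hω g = polyHom hω a * (1 + u) := by
    rw [hu, map_sub, ← polyHom_apply]
    field_simp
    ring
  -- Here the weight is `-d` and the order `1`, which equals `δ⁻¹ * (-d) + (1 + δ⁻¹ * d)`.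
  have hinv : (polyHom hω a)⁻¹ ∈ (quotientFiltration hω ha0 ha).series δ⁻¹ (1 + δ⁻¹ * d) := by
    have := seriesHom_div_mem_series (hω := hω) ha0 ha (A := δ⁻¹) (B := 1 + δ⁻¹ * d) (m := 1)
      (f := 1) fun β hβ => by
        rw [MvPowerSeries.coeff_one] at hβ
        rw [show β = 0 by by_contra h; simp [h] at hβ, map_zero]
        simp
    rwa [map_one, pow_one, one_div] at this
  refine ⟨a, d, ha0, ha, δ⁻¹, 1 + δ⁻¹ * d, by positivity, by positivity, ?_⟩
  rw [hgu, mul_inv]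
  simpa using PoleFiltration.mul_mem_series hinv (PoleFiltration.inv_one_add_mem_series huS hu1)

/-- Finitely many elements of `ℂ((x))` have linearly growing poles along a common polynomial. -/
theorem exists_forall_mem_series (s : Finset (SeriesField n)) :
    ∃ (a : MvPolynomial (Fin n) ℂ) (d : ℝ) (ha0 : a ≠ 0)
      (ha : MvPolynomial.IsWeightedHomogeneous ω a d) (A B : ℝ), 0 ≤ B ∧
        ∀ z ∈ s, algebraMap (SeriesField n) (CompletedField ω hω) z ∈
          (quotientFiltration hω ha0 ha).series A B := by
  obtain ⟨g, hg⟩ := IsLocalization.exist_integer_multiples_of_finset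
    (nonZeroDivisors (MvPowerSeries (Fin n) ℂ)) s
  have hg0 : (g : MvPowerSeries (Fin n) ℂ) ≠ 0 := nonZeroDivisors.coe_ne_zero g
  obtain ⟨a, d, ha0, ha, A, B, hA, hB, hinv⟩ := exists_inv_mem_series (hω := hω) hg0
  refine ⟨a, d, ha0, ha, A, B, hB, fun z hz => ?_⟩
  obtain ⟨f, hf⟩ := hg z hz
  have hfS : seriesHom hω f ∈ (quotientFiltration hω ha0 ha).series A 0 := by
    have := seriesHom_div_mem_series (hω := hω) ha0 ha (A := A) (B := 0) (m := 0) (f := f)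
      fun α _ => by
        rw [Nat.cast_zero, zero_mul, sub_zero, add_zero, Finsupp.weight_eq_sum]
        exact mul_nonneg hA (Finset.sum_nonneg fun i _ => nsmul_nonneg (hω i).le _)
    simpa using this
  have hz' : algebraMap (SeriesField n) (CompletedField ω hω) z =
      seriesHom hω f * (seriesHom hω g)⁻¹ := by
    rw [eq_mul_inv_iff_mul_eq₀ (seriesHom_ne_zero hω hg0)]
    simp only [seriesHom, RingHom.comp_apply]
    rw [hf, Algebra.smul_def, map_mul, mul_comm]
  rw [hz']
  simpa using PoleFiltration.mul_mem_series hfS hinv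

/-! ### Elements algebraic over `ℂ((x))` -/

instance charZero_seriesField : CharZero (SeriesField n) :=
  charZero_of_injective_algebraMap
    (R := ℂ) ((algebraMap (MvPowerSeries (Fin n) ℂ) (SeriesField n)).comp
      MvPowerSeries.C).injective

/-- An algebraic element of a completion is, up to an element of the base field, a small root of
an equation of Hensel type. -/
theorem exists_hensel_equation {K L : Type*} [Field K] [CharZero K] [NormedField L] [Algebra K L]
    (hdense : DenseRange (algebraMap K L)) {ξ : L} (hξ : IsAlgebraic K ξ) :
    ∃ (y c₀ : K) (c : ℕ → K) (N : ℕ) (M w : ℝ), 0 ≤ M ∧ M < w ∧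
      ξ - algebraMap K L y = algebraMap K L c₀ +
        ∑ k ∈ Finset.range N, algebraMap K L (c k) * (ξ - algebraMap K L y) ^ (k + 2) ∧
      (∀ k < N, ‖algebraMap K L (c k)‖ ≤ Real.exp M) ∧
      ‖ξ - algebraMap K L y‖ ≤ Real.exp (-w) := by
  set P := minpoly K ξ with hP
  set p := P.map (algebraMap K L) with hp
  have hroot : p.eval ξ = 0 := by
    rw [hp, Polynomial.eval_map_algebraMap]; exact minpoly.aeval K ξ
  have hder : p.derivative.eval ξ ≠ 0 := by
    have hsep : P.Separable := (minpoly.irreducible hξ.isIntegral).separable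
    have h := hsep.aeval_derivative_ne_zero (minpoly.aeval K ξ)
    rwa [hp, Polynomial.derivative_map, Polynomial.eval_map_algebraMap]
  set N := p.natDegree with hN
  set q : ℕ → L → L :=
    fun k s => -((Polynomial.hasseDeriv (k + 2) p).eval s / p.derivative.eval s) with hq
  -- The leading `1` gives `0 ≤ M` and makes `‖q k ξ‖ < e^M` strict, so the bound persists at points
  -- near `ξ`.
  set M := Real.log (1 + ∑ k ∈ Finset.range N, (‖q k ξ‖ + 1)) with hM
  have hsum0 : 0 ≤ ∑ k ∈ Finset.range N, (‖q k ξ‖ + 1) :=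
    Finset.sum_nonneg fun k _ => by positivity
  have hM0 : 0 ≤ M := Real.log_nonneg (by linarith)
  have hexpM : Real.exp M = 1 + ∑ k ∈ Finset.range N, (‖q k ξ‖ + 1) := Real.exp_log (by linarith)
  have hqM : ∀ k < N, ‖q k ξ‖ < Real.exp M := fun k hk => by
    have := Finset.single_le_sum (f := fun k => ‖q k ξ‖ + 1) (fun k _ => by positivity)
      (Finset.mem_range.2 hk)
    rw [hexpM]
    linarith
  have hcont : ∀ k, ContinuousAt (q k) ξ := fun k =>
    ((Polynomial.continuous _).continuousAt.div (Polynomial.continuous _).continuousAt hder).neg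
  have hev : ∀ᶠ s in 𝓝 ξ, (∀ k ∈ Finset.range N, ‖q k s‖ < Real.exp M) ∧
      p.derivative.eval s ≠ 0 ∧ ‖ξ - s‖ < Real.exp (-(M + 1)) := by
    refine Eventually.and ?_ (Eventually.and ?_ ?_)
    · rw [eventually_all_finset]
      exact fun k hk => (hcont k).norm.eventually_lt_const (hqM k (Finset.mem_range.1 hk))
    · exact (Polynomial.continuous _).continuousAt.eventually_ne hder
    · filter_upwards [Metric.ball_mem_nhds ξ (Real.exp_pos (-(M + 1)))] with s hs
      rwa [← dist_eq_norm, dist_comm]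
  obtain ⟨y, hyq, hyd, hyw⟩ := hdense.mem_nhds hev
  set T := Polynomial.taylor y P with hT
  have hcoeff : ∀ j, algebraMap K L (T.coeff j) =
      (Polynomial.hasseDeriv j p).eval (algebraMap K L y) := fun j => by
    rw [← Polynomial.coeff_map, hT, Polynomial.map_taylor, Polynomial.taylor_coeff]
  have hc : ∀ k, algebraMap K L (-(T.coeff (k + 2) / T.coeff 1)) = q k (algebraMap K L y) :=
    fun k => by rw [map_neg, map_div₀, hcoeff, hcoeff, Polynomial.hasseDeriv_one']
  refine ⟨y, -(T.coeff 0 / T.coeff 1), fun k => -(T.coeff (k + 2) / T.coeff 1), N, M, M + 1,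
    hM0, by linarith, ?_, fun k hk => ?_, hyw.le⟩
  · have h1 : algebraMap K L (T.coeff 1) ≠ 0 := by
      rwa [hcoeff, Polynomial.hasseDeriv_one']
    set η := ξ - algebraMap K L y with hη
    have h0 : (T.map (algebraMap K L)).eval η = 0 := by
      rw [hT, Polynomial.map_taylor, Polynomial.taylor_eval, hη, sub_add_cancel, ← hp, hroot]
    -- Summing past the degree adds only zero coefficients. Once the constant and linear terms are
    -- split off, exactly `N` terms remain.
    have hdeg : (T.map (algebraMap K L)).natDegree < N + 2 := by
      rw [hT, Polynomial.map_taylor, Polynomial.natDegree_taylor, ← hp]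
      omega
    rw [Polynomial.eval_eq_sum_range' hdeg, Finset.sum_range_succ', Finset.sum_range_succ'] at h0
    simp only [Polynomial.coeff_map, zero_add, pow_one, pow_zero, mul_one] at h0
    simp only [map_neg, map_div₀, neg_mul, Finset.sum_neg_distrib, div_mul_eq_mul_div]
    rw [← Finset.sum_div, ← neg_add, ← add_div, eq_neg_iff_add_eq_zero]
    rw [← mul_left_inj' h1, zero_mul, add_mul, div_mul_cancel₀ _ h1, ← h0]
    ring
  · rw [hc]
    exact (hyq k (Finset.mem_range.2 hk)).le

/-- Elements algebraic over `ℂ((x))` have linearly growing poles along some polynomial. -/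
theorem exists_mem_series_of_isAlgebraic {ξ : CompletedField ω hω}
    (hξ : IsAlgebraic (SeriesField n) ξ) :
    ∃ (a : MvPolynomial (Fin n) ℂ) (d : ℝ) (ha0 : a ≠ 0)
      (ha : MvPolynomial.IsWeightedHomogeneous ω a d) (A B : ℝ),
        ξ ∈ (quotientFiltration hω ha0 ha).series A B := by
  classical
  obtain ⟨y, c₀, c, N, M, w, hM, hMw, heq, hcM, hw⟩ :=
    exists_hensel_equation denseRange_algebraMap hξ
  obtain ⟨a, d, ha0, ha, A, B, hB, hmem⟩ :=
    exists_forall_mem_series (hω := hω) (insert y (insert c₀ ((Finset.range N).image c)))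
  obtain ⟨A', B₁, hA, hη⟩ := PoleFiltration.exists_mem_series_of_root heq hB
    (hmem c₀ (by simp))
    (fun k hk => hmem (c k) (by
      simp only [Finset.mem_insert, Finset.mem_image, Finset.mem_range]
      exact Or.inr (Or.inr ⟨k, hk, rfl⟩))) hM hMw hcM hw
  obtain ⟨B₂, hy⟩ := PoleFiltration.exists_mem_series_of_le (hmem y (by simp)) hA
  refine ⟨a, d, ha0, ha, A', max B₁ B₂, ?_⟩
  have := add_mem (PoleFiltration.series_mono_right (le_max_left B₁ B₂) hη)
    (PoleFiltration.series_mono_right (le_max_right B₁ B₂) hy)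
  rwa [sub_add_cancel] at this

end Completion

end WeightedSeries

/-! ### The expansion of an algebraic element -/

/-- Here `ν_ω(ξ) ≥ ℓ₀` is written `‖ξ‖ ≤ e^{-ℓ₀}`; the series runs over all real `ℓ`, with
`a_ℓ = c ℓ` and only finitely many nonzero terms below any bound. -/
theorem theorem3p6 (n : ℕ) (ω : Fin n → ℝ) (hω : ∀ i, 0 < ω i)
    (ξ : WeightedSeries.CompletedField ω hω)
    (hξ : IsAlgebraic (WeightedSeries.SeriesField n) ξ)
    (ℓ₀ : ℝ) (hℓ₀ : ‖ξ‖ ≤ Real.exp (-ℓ₀)) :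
    ∃ a : MvPolynomial (Fin n) ℂ, a ≠ 0 ∧ WeightedSeries.IsWHomogeneous ω a ∧
      ∃ c : ℝ → MvPolynomial (Fin n) ℂ,
        (∀ ℓ, WeightedSeries.IsWHomogeneous ω (c ℓ)) ∧
        (∀ ℓ, c ℓ ≠ 0 → ℓ₀ ≤ ℓ ∧
          WeightedSeries.val ω (WeightedSeries.ofPoly (c ℓ) /
            WeightedSeries.ofPoly a ^ (⌈ℓ - ℓ₀⌉₊ + 1)) = ℓ) ∧
        (∀ r : ℝ, {ℓ : ℝ | ℓ ≤ r ∧ c ℓ ≠ 0}.Finite) ∧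
        HasSum (fun ℓ : ℝ =>
          algebraMap (WeightedSeries.SeriesField n) (WeightedSeries.CompletedField ω hω)
            (WeightedSeries.ofPoly (c ℓ) / WeightedSeries.ofPoly a ^ (⌈ℓ - ℓ₀⌉₊ + 1))) ξ := by
  open WeightedSeries in
  obtain ⟨a, d, ha0, ha, A, B, hS⟩ := exists_mem_series_of_isAlgebraic hξ
  obtain ⟨h, hpiece, hnorm, hfin, hsum⟩ := PoleFiltration.exists_hasSum hS
  obtain ⟨N, hN⟩ := exists_nat_ge (max A (A * ℓ₀ + B))
  have ha' := polyHom_ne_zero hω ha0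
  have hex : ∀ ℓ, ∃ b : MvPolynomial (Fin n) ℂ, IsWHomogeneous ω b ∧ (b ≠ 0 → h ℓ ≠ 0) ∧
      h ℓ = polyHom hω b / polyHom hω (a ^ N) ^ (⌈ℓ - ℓ₀⌉₊ + 1) := by
    intro ℓ
    by_cases h0 : h ℓ = 0
    · exact ⟨0, ⟨0, MvPolynomial.isWeightedHomogeneous_zero _ _ _⟩, by simp, by simp [h0]⟩
    have hℓ : ℓ₀ ≤ ℓ := by
      have := (hnorm ℓ).trans hℓ₀
      rw [PoleFiltration.norm_eq _ (hpiece ℓ) h0, Real.exp_le_exp] at this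
      linarith
    rcases mem_quotientFiltration_piece.1 (hpiece ℓ) with h1 | ⟨m, b, hm, hb, hbe⟩
    · exact absurd h1 h0
    have hle : m ≤ N * (⌈ℓ - ℓ₀⌉₊ + 1) := by
      have h1 := Nat.le_ceil (ℓ - ℓ₀)
      have h2 := (le_max_left _ _).trans hN
      have h3 := (le_max_right _ _).trans hN
      -- `m ≤ A * ℓ + B = A * (ℓ - ℓ₀) + (A * ℓ₀ + B) ≤ N * (ℓ - ℓ₀) + N`.
      have h4 : (m : ℝ) ≤ N * (⌈ℓ - ℓ₀⌉₊ + 1) := by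
        nlinarith [mul_le_mul_of_nonneg_right h2 (sub_nonneg.2 hℓ),
          mul_le_mul_of_nonneg_left h1 (Nat.cast_nonneg (α := ℝ) N)]
      exact_mod_cast h4
    obtain ⟨k, hk⟩ := Nat.exists_eq_add_of_le hle
    refine ⟨b * a ^ k, ⟨_, hb.mul (ha.pow k)⟩, fun _ => h0, ?_⟩
    rw [map_pow, ← pow_mul, hk, map_mul, map_pow, hbe, pow_add]
    field_simp
  choose c hcH hc0 hce using hex
  have hterm : ∀ ℓ, algebraMap (SeriesField n) (CompletedField ω hω)
      (ofPoly (c ℓ) / ofPoly (a ^ N) ^ (⌈ℓ - ℓ₀⌉₊ + 1)) = h ℓ := fun ℓ => by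
    rw [hce, map_div₀, map_pow]; rfl
  refine ⟨a ^ N, pow_ne_zero N ha0, ⟨_, ha.pow N⟩, c, hcH, fun ℓ hℓ => ?_, fun r => ?_, ?_⟩
  · have h0 := hc0 ℓ hℓ
    have h1 := PoleFiltration.norm_eq _ (hpiece ℓ) h0
    constructor
    · have := (hnorm ℓ).trans hℓ₀
      rw [h1, Real.exp_le_exp] at this
      linarith
    · rw [← hterm, norm_algebraMap_completedField, absVal_of_ne_zero, Real.exp_eq_exp, neg_inj] at h1
      · exact h1
      · intro hz
        exact h0 (by rw [← hterm, hz, map_zero])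
  · exact (hfin r).subset fun ℓ hℓ => ⟨hℓ.1, hc0 ℓ hℓ.2⟩
  · simpa only [hterm] using hsum
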